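/- Let $\widehat{\mathfrak g}$ be of type $A_n^{(1)}$ ($n\ge1$), $B_n^{(1)}$ ($n\ge3$), $C_n^{(1)}$ ($n\ge2$) or $D_n^{(1)}$ ($n\ge4$), with Cartan matrix $(A_{ij})_{0\le i,j\le n}$, $A_{ij}=\langle\alpha_j,h_i\rangle$, and $(\alpha_i|\alpha_j)=d_iA_{ij}$, where $d_i=1$ except that $(d_0,\dots,d_n)=(1,\dots,1,\tfrac12)$ for $B_n^{(1)}$ and $(1,\tfrac12,\dots,\tfrac12,1)$ for $C_n^{(1)}$. Put $K=\mathbb C(q^{1/2})$, $q_i=q^{d_i}$, $[m]_i=\frac{q_i^m-q_i^{-m}}{q_i-q_i^{-1}}$. Let $U_q(\widehat{\mathfrak g})$ be the $K$-algebra generated by $e_i,f_i$ and $q^h$ ($h\in\bigoplus_i\mathbb Z\,d_ih_i\oplus\mathbb Zd$) with the Drinfeld–Jimbo relations, $t_i=q^{d_ih_i}$, let $U_q'(\widehat{\mathfrak g})$ be its subalgebra generated by $e_i,f_i,t_i^{\pm1}$, with coproduct $\Delta(e_i)=e_i\otimes1+t_i\otimes e_i$, $\Delta(f_i)=f_i\otimes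 t_i^{-1}+1\otimes f_i$, $\Delta(t_i)=t_i\otimes t_i$ and antipode $S(e_i)=-t_i^{-1}e_i$, $S(f_i)=-f_it_i$, $S(t_i)=t_i^{-1}$. Consider the following colored graph with vertex set $J$. Type $A_n^{(1)}$: $J=\{1,\dots,n+1\}$, arrows $k\xrightarrow{k}k+1$ ($1\le k\le n$), $n+1\xrightarrow{0}1$. Type $B_n^{(1)}$: $J=\{1,\dots,n,0,\overline n,\dots,\overline1\}$, arrows $k\xrightarrow{k}k+1$, $\overline{k+1}\xrightarrow{k}\overline k$ ($1\le k<n$), $n\xrightarrow{n}0\xrightarrow{n}\overline n$, $\overline2\xrightarrow{0}1$, $\overline1\xrightarrow{0}2$. Type $C_n^{(1)}$: $J=\{1,\dots,n,\overline n,\dots,\overline1\}$, arrows $k\xrightarrow{k}k+1$, $\overline{k+1}\xrightarrow{k}\overline k$ ($1\le k<n$), $n\xrightarrow{n}\overline n$, $\overline1\xrightarrow{0}1$. Type $D_n^{(1)}$: $J=\{1,\dots,n,\overline n,\dots,\overline1\}$, arrows $k\xrightarrow{k}k+1$, $\overline{k+1}\xrightarrow{k}\overline k$ ($1\le k<n$),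 $n-1\xrightarrow{n}\overline n$, $n\xrightarrow{n}\overline{n-1}$, $\overline2\xrightarrow{0}1$, $\overline1\xrightarrow{0}2$. The last vertex is $n+1$ in type $A_n^{(1)}$ and $\overline1$ otherwise. For a vertex $j$ and a color $k$ let $\varepsilon_k(j)$ and $\varphi_k(j)$ be the numbers of $k$-arrows coming into and going out of $j$, counted along the whole $k$-string through $j$, and $(\mathrm{wt}(j),h_k)=\varphi_k(j)-\varepsilon_k(j)$. Let $V$ be the $U_q'(\widehat{\mathfrak g})$-module with basis $(v_j)_{j\in J}$ in which $t_kv_j=q_k^{(\mathrm{wt}(j),h_k)}v_j$ and, for every arrow $i\xrightarrow{k}j$, $f_kv_i=[\varepsilon_k(j)]_kv_j$ and $e_kv_j=[\varphi_k(i)]_kv_i$, all other $f_kv_i$ and $e_kv_j$ being $0$. Let $V^*$ be the dual module, $(x\cdot v^*)(u)=v^*(S(x)u)$, with dual basis $(v_j^*)$. For $W=V$ or $V^*$ let $W_z=W\otimes K[z,z^{-1}]$ with $e_k(w z^m)=(e_kw)z^{m+\delta_{k0}}$, $f_k(wz^m)=(f_kw)z^{m-\delta_{k0}}$, $t_k(wz^m)=(t_kw)z^m$.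 Let $V(\lambda),V(\mu)$ be highest weight $U_q(\widehat{\mathfrak g})$-modules (for instance integrable ones). A type I vertex operator with respect to $W_z$ is a $U_q'(\widehat{\mathfrak g})$-linear map $V(\lambda)\to V(\mu)\,\widehat\otimes\,W_z$, where $V(\mu)\,\widehat\otimes\,W_z$ is the space of formal series $\sum_{m\in\mathbb Z}x_mz^m$ with $x_m\in V(\mu)\otimes W$, on which $U_q'(\widehat{\mathfrak g})$ acts through $\Delta$. Its components are the formal series of operators $\Phi_j(z)$, resp. $\Phi_j^*(z)$, given by $\Phi(z)u=\sum_{j\in J}\Phi_j(z)u\otimes v_j$, resp. $\Phi^*(z)u=\sum_{j\in J}\Phi^*_j(z)u\otimes v_j^*$. Write $[a,b]_c=ab-c\,ba$. (1) A type I vertex operator $\Phi(z)$ with respect to $V_z$ is determined by its component at the last vertex: two such operators $V(\lambda)\to V(\mu)\,\widehat\otimes\,V_z$ with the same component there are equal. For every arrow $i\xrightarrow{k}j$, with $r_j=\varepsilon_k(j)$, $$\Phi_i(z)=z^{\delta_{k0}}\,[r_j]_k^{-1}\,[\Phi_j(z),f_k]_{q_k^{-(\mathrm{wt}(j),h_k)}}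 .$$ (2) A type I vertex operator $\Phi^*(z)$ with respect to $V_z^*$ is determined, in the same sense, by its component $\Phi_1^*(z)$. For every arrow $i\xrightarrow{k}j$, with $r_j=\varepsilon_k(j)$, $$\Phi_j^*(z)=z^{\delta_{k0}}\,[r_j]_k^{-1}\,[f_k,\Phi_i^*(z)]_{q_k^{-(\mathrm{wt}(i),h_k)}} .$$ -/

import Mathlib

open scoped TensorProduct

namespace QAffine

noncomputable section

/-! ### The ground field and the affine Cartan data -/

/-- The ground field `ℂ(q^{1/2})`, the variable of `RatFunc` being `q^{1/2}`. -/
abbrev K : Type := RatFunc ℂ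

/-- `q^{1/2}`. -/
def qHalf : K := RatFunc.X

/-- The four untwisted classical affine families `A_n^{(1)}, B_n^{(1)}, C_n^{(1)}, D_n^{(1)}`. -/
inductive AffType : Type
  | A | B | C | D

/-- The usual smallest rank `n` in each family. -/
def AffType.minRank : AffType → ℕ
  | .A => 1
  | .B => 3
  | .C => 2
  | .D => 4

/-- The generalized Cartan matrix `(A_{ij})`, `i, j ∈ {0, …, n}`, with `A_{ij} = ⟨α_j, h_i⟩`.
In type `A` the indices are cyclic (so the off-diagonal entries are `-2` for `n = 1`). -/
def cartan : AffType → (n : ℕ) → Fin (n + 1) → Fin (n + 1) → ℤ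
  | .A, _, i, j =>
      (if i = j then 2 else 0) - (if j = i + 1 then 1 else 0) - (if i = j + 1 then 1 else 0)
  | .B, n, i, j =>
      if i = j then 2
      else if (i : ℕ) = n ∧ (j : ℕ) + 1 = n then -2
      else if ((i : ℕ) = 0 ∧ (j : ℕ) = 2) ∨ ((j : ℕ) = 0 ∧ (i : ℕ) = 2)
        ∨ (1 ≤ (i : ℕ) ∧ (j : ℕ) = i + 1) ∨ (1 ≤ (j : ℕ) ∧ (i : ℕ) = j + 1) then -1
      else 0
  | .C, n, i, j =>
      if i = j then 2
      else if ((i : ℕ) = 1 ∧ (j : ℕ) = 0) ∨ ((j : ℕ) = n ∧ (i : ℕ) + 1 = n) then -2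
      else if (j : ℕ) = i + 1 ∨ (i : ℕ) = j + 1 then -1
      else 0
  | .D, n, i, j =>
      if i = j then 2
      else if ((i : ℕ) = 0 ∧ (j : ℕ) = 2) ∨ ((j : ℕ) = 0 ∧ (i : ℕ) = 2)
        ∨ ((i : ℕ) = n ∧ (j : ℕ) + 2 = n) ∨ ((j : ℕ) = n ∧ (i : ℕ) + 2 = n)
        ∨ (1 ≤ (i : ℕ) ∧ (j : ℕ) = i + 1 ∧ (j : ℕ) < n)
        ∨ (1 ≤ (j : ℕ) ∧ (i : ℕ) = j + 1 ∧ (i : ℕ) < n) then -1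
      else 0

/-- `2 d_i = (α_i|α_i)`, where `d = (1, …, 1, 1/2)` in type `B`, `d = (1, 1/2, …, 1/2, 1)` in
type `C`, and `d_i = 1` otherwise. -/
def twoD : AffType → (n : ℕ) → Fin (n + 1) → ℤ
  | .B, n, i => if (i : ℕ) = n then 1 else 2
  | .C, n, i => if (i : ℕ) = 0 ∨ (i : ℕ) = n then 2 else 1
  | .A, _, _ => 2
  | .D, _, _ => 2

/-- `q_i = q^{d_i}`. -/
def qi (X : AffType) (n : ℕ) (i : Fin (n + 1)) : K := qHalf ^ twoD X n i

/-- The `q`-integer `[m]_i = (q_i^m - q_i^{-m}) / (q_i - q_i^{-1})`. -/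
def qInt (X : AffType) (n : ℕ) (i : Fin (n + 1)) (m : ℕ) : K :=
  (qi X n i ^ m - (qi X n i)⁻¹ ^ m) / (qi X n i - (qi X n i)⁻¹)

/-- `[m]_i! = [1]_i ⋯ [m]_i`. -/
def qFact (X : AffType) (n : ℕ) (i : Fin (n + 1)) (m : ℕ) : K :=
  ∏ k ∈ Finset.range m, qInt X n i (k + 1)

/-! ### The quantum affine algebra -/

/-- The lattice indexing the Cartan part: `(a, b)` stands for `h = ∑ a_i (d_i h_i) + b d`.
It contains all `h_i` and `d`, and the exponents `d_i h_i` of `t_i = q_i^{h_i} = q^{d_i h_i}`. -/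
abbrev Coweight (n : ℕ) : Type := (Fin (n + 1) → ℤ) × ℤ

/-- `2 α_i(h)`, where `α_i(h_j) = A_{ji}` and `α_i(d) = δ_{i0}`. -/
def twoRoot (X : AffType) (n : ℕ) (i : Fin (n + 1)) (h : Coweight n) : ℤ :=
  (∑ j, h.1 j * (twoD X n j * cartan X n j i)) + if i = 0 then 2 * h.2 else 0

/-- Generators `e_i`, `f_i`, `q^h` of `U_q(ĝ)`. -/
inductive Gen (n : ℕ) : Type
  | e (i : Fin (n + 1))
  | f (i : Fin (n + 1))
  | qpow (h : Coweight n)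

/-- The coweight `d_i h_i`. -/
def dh {n : ℕ} (i : Fin (n + 1)) : Coweight n := (Pi.single i 1, 0)

/-- The free algebra on the generators. -/
abbrev Free (n : ℕ) : Type := FreeAlgebra K (Gen n)

/-- The generator `g` in the free algebra. -/
abbrev fr {n : ℕ} (g : Gen n) : Free n := FreeAlgebra.ι K g

/-- `x^{(m)} = x^m / [m]_i!`. -/
def divPow (X : AffType) (n : ℕ) (i : Fin (n + 1)) (x : Free n) (m : ℕ) : Free n :=
  (qFact X n i m)⁻¹ • x ^ m

/-- The quantum Serre expression
`∑_{m + m' = 1 - A_{ij}} (-1)^m x_i^{(m)} x_j x_i^{(m')}`. -/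
def serre (X : AffType) (n : ℕ) (i j : Fin (n + 1)) (xi xj : Free n) : Free n :=
  ∑ p ∈ Finset.HasAntidiagonal.antidiagonal (1 - cartan X n i j).toNat,
    (-1) ^ p.1 * divPow X n i xi p.1 * xj * divPow X n i xi p.2

/-- The defining relations of `U_q(ĝ)`. -/
inductive Rel (X : AffType) (n : ℕ) : Free n → Free n → Prop
  | q_zero : Rel X n (fr (.qpow 0)) 1
  | q_add (h h' : Coweight n) :
      Rel X n (fr (.qpow h) * fr (.qpow h')) (fr (.qpow (h + h')))
  | q_e (h : Coweight n) (i : Fin (n + 1)) :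
      Rel X n (fr (.qpow h) * fr (.e i) * fr (.qpow (-h)))
        (qHalf ^ twoRoot X n i h • fr (.e i))
  | q_f (h : Coweight n) (i : Fin (n + 1)) :
      Rel X n (fr (.qpow h) * fr (.f i) * fr (.qpow (-h)))
        (qHalf ^ (-twoRoot X n i h) • fr (.f i))
  | e_f_same (i : Fin (n + 1)) :
      Rel X n (fr (.e i) * fr (.f i) - fr (.f i) * fr (.e i))
        ((qi X n i - (qi X n i)⁻¹)⁻¹ • (fr (.qpow (dh i)) - fr (.qpow (-dh i))))
  | e_f_diff (i j : Fin (n + 1)) (hij : i ≠ j) :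
      Rel X n (fr (.e i) * fr (.f j) - fr (.f j) * fr (.e i)) 0
  | serre_e (i j : Fin (n + 1)) (hij : i ≠ j) :
      Rel X n (serre X n i j (fr (.e i)) (fr (.e j))) 0
  | serre_f (i j : Fin (n + 1)) (hij : i ≠ j) :
      Rel X n (serre X n i j (fr (.f i)) (fr (.f j))) 0

/-- The quantum affine algebra `U_q(ĝ)` over `ℂ(q^{1/2})`. -/
abbrev Uq (X : AffType) (n : ℕ) : Type := RingQuot (Rel X n)

/-- The image of a generator in `U_q(ĝ)`. -/
def gen (X : AffType) (n : ℕ) (g : Gen n) : Uq X n := RingQuot.mkAlgHom K (Rel X n) (fr g)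

/-- The algebra generators `e_i, f_i, t_i, t_i⁻¹` of the derived subalgebra `U_q'(ĝ)`. -/
inductive DGen (n : ℕ) : Type
  | e (i : Fin (n + 1))
  | f (i : Fin (n + 1))
  | t (i : Fin (n + 1))
  | tinv (i : Fin (n + 1))

/-- The elements `e_i, f_i, t_i^{± 1}` of `U_q(ĝ)`. -/
def DGen.toUq (X : AffType) {n : ℕ} : DGen n → Uq X n
  | .e i => gen X n (.e i)
  | .f i => gen X n (.f i)
  | .t i => gen X n (.qpow (dh i))
  | .tinv i => gen X n (.qpow (-dh i))

/-- The operator by which `g` acts on a `U_q(ĝ)`-module. -/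
def act (X : AffType) {n : ℕ} (M : Type*) [AddCommGroup M] [Module K M] [Module (Uq X n) M]
    [IsScalarTower K (Uq X n) M] (g : DGen n) : M →ₗ[K] M :=
  Algebra.lsmul K K M (g.toUq X)

/-- `M` is a highest weight `U_q(ĝ)`-module: it is generated by a nonzero vector `v` with
`e_i v = 0` and `q^h v = lam(h) v`. The highest weight is recorded as the function
`lam : h ↦ q^{λ(h)}`. -/
def IsHighestWeightModule (X : AffType) (n : ℕ) (lam : Coweight n → K)
    (M : Type*) [AddCommGroup M] [Module K M] [Module (Uq X n) M] : Prop :=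
  ∃ v : M, v ≠ 0 ∧ (∀ i, gen X n (.e i) • v = 0) ∧ (∀ h, gen X n (.qpow h) • v = lam h • v) ∧
    Submodule.span (Uq X n) {v} = ⊤

/-! ### The representation graphs -/

/-- Labels `i`, `0`, `ī` of vertices. -/
inductive Label : Type
  | pos (i : ℕ)
  | zero
  | bar (i : ℕ)
  deriving DecidableEq

/-- The vertices: `1, …, n+1` in type `A`; `1, …, n, 0, n̄, …, 1̄` in type `B`;
`1, …, n, n̄, …, 1̄` in types `C` and `D`. -/
def vertices : AffType → ℕ → Finset Label
  | .A, n => (Finset.Icc 1 (n + 1)).image .pos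
  | .B, n => insert .zero ((Finset.Icc 1 n).image .pos ∪ (Finset.Icc 1 n).image .bar)
  | .C, n => (Finset.Icc 1 n).image .pos ∪ (Finset.Icc 1 n).image .bar
  | .D, n => (Finset.Icc 1 n).image .pos ∪ (Finset.Icc 1 n).image .bar

/-- The index set `J` of the basis of `V`. -/
abbrev Vertex (X : AffType) (n : ℕ) : Type := {l : Label // l ∈ vertices X n}

/-- `LabelArrow X n k a b`: there is an arrow `a → b` of color `k` in the representation graph. -/
inductive LabelArrow : AffType → ℕ → ℕ → Label → Label → Prop
  | A_pos (n k : ℕ) (h1 : 1 ≤ k) (h2 : k ≤ n) : LabelArrow .A n k (.pos k) (.pos (k + 1))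
  | A_aff (n : ℕ) : LabelArrow .A n 0 (.pos (n + 1)) (.pos 1)
  | B_pos (n k : ℕ) (h1 : 1 ≤ k) (h2 : k < n) : LabelArrow .B n k (.pos k) (.pos (k + 1))
  | B_bar (n k : ℕ) (h1 : 1 ≤ k) (h2 : k < n) : LabelArrow .B n k (.bar (k + 1)) (.bar k)
  | B_to_zero (n : ℕ) : LabelArrow .B n n (.pos n) .zero
  | B_from_zero (n : ℕ) : LabelArrow .B n n .zero (.bar n)
  | B_aff1 (n : ℕ) : LabelArrow .B n 0 (.bar 2) (.pos 1)
  | B_aff2 (n : ℕ) : LabelArrow .B n 0 (.bar 1) (.pos 2)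
  | C_pos (n k : ℕ) (h1 : 1 ≤ k) (h2 : k < n) : LabelArrow .C n k (.pos k) (.pos (k + 1))
  | C_bar (n k : ℕ) (h1 : 1 ≤ k) (h2 : k < n) : LabelArrow .C n k (.bar (k + 1)) (.bar k)
  | C_mid (n : ℕ) : LabelArrow .C n n (.pos n) (.bar n)
  | C_aff (n : ℕ) : LabelArrow .C n 0 (.bar 1) (.pos 1)
  | D_pos (n k : ℕ) (h1 : 1 ≤ k) (h2 : k < n) : LabelArrow .D n k (.pos k) (.pos (k + 1))
  | D_bar (n k : ℕ) (h1 : 1 ≤ k) (h2 : k < n) : LabelArrow .D n k (.bar (k + 1)) (.bar k)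
  | D_mid1 (n m : ℕ) (h : m + 1 = n) : LabelArrow .D n n (.pos m) (.bar n)
  | D_mid2 (n m : ℕ) (h : m + 1 = n) : LabelArrow .D n n (.pos n) (.bar m)
  | D_aff1 (n : ℕ) : LabelArrow .D n 0 (.bar 2) (.pos 1)
  | D_aff2 (n : ℕ) : LabelArrow .D n 0 (.bar 1) (.pos 2)

/-- The arrows of color `k` between vertices. -/
def Arrow (X : AffType) (n : ℕ) (k : Fin (n + 1)) (a b : Vertex X n) : Prop :=
  LabelArrow X n k a.1 b.1

/-- The number of `k`-arrows coming into `j`, counted along the whole `k`-string through `j`: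
the arrows `a → b` of color `k` from whose end `b` the vertex `j` is reached by `k`-arrows. -/
def inCount (X : AffType) (n : ℕ) (k : Fin (n + 1)) (j : Vertex X n) : ℕ :=
  {p : Vertex X n × Vertex X n |
    Arrow X n k p.1 p.2 ∧ Relation.ReflTransGen (Arrow X n k) p.2 j}.ncard

/-- The number of `k`-arrows going out of `j`, counted along the whole `k`-string. -/
def outCount (X : AffType) (n : ℕ) (k : Fin (n + 1)) (j : Vertex X n) : ℕ :=
  {p : Vertex X n × Vertex X n |
    Arrow X n k p.1 p.2 ∧ Relation.ReflTransGen (Arrow X n k) j p.1}.ncard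

/-- `(wt(j), h_k)`, the coefficient of `Λ_k` in the weight of the vertex `j`. -/
def wt (X : AffType) (n : ℕ) (j : Vertex X n) (k : Fin (n + 1)) : ℤ :=
  (outCount X n k j : ℤ) - inCount X n k j

/-- The vertex `1`. -/
def firstVertex (X : AffType) (n : ℕ) (hn : X.minRank ≤ n) : Vertex X n :=
  ⟨.pos 1, by cases X <;> simp [AffType.minRank, vertices] at hn ⊢ <;> omega⟩

/-- The last vertex: `n+1` in type `A`, and `1̄` in types `B`, `C`, `D`. -/
def lastVertex : (X : AffType) → (n : ℕ) → (hn : X.minRank ≤ n) → Vertex X n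
  | .A, n, _ => ⟨.pos (n + 1), by simp [vertices]⟩
  | .B, _, hn => ⟨.bar 1, by simp [AffType.minRank, vertices] at hn ⊢; omega⟩
  | .C, _, hn => ⟨.bar 1, by simp [AffType.minRank, vertices] at hn ⊢; omega⟩
  | .D, _, hn => ⟨.bar 1, by simp [AffType.minRank, vertices] at hn ⊢; omega⟩

/-! ### The representation `V`, its dual, and the completed tensor products -/

/-- The space `V` with basis `(v_j)`. -/
abbrev V (X : AffType) (n : ℕ) : Type := Vertex X n → K

/-- The basis vector `v_j`. -/
def vbasis (X : AffType) (n : ℕ) (j : Vertex X n) : V X n := Pi.single j 1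

open Classical in
/-- The action of the generators of `U_q'(ĝ)` on `V` read off from the graph: for an arrow
`a → b` of color `k`, `f_k v_a = [r_b]_k v_b` and `e_k v_b = [r'_a]_k v_a`, where `r_b` is the
number of `k`-arrows coming into `b` and `r'_a` the number of those going out of `a`; all
other `f_k v_a`, `e_k v_b` vanish; and `t_k v_a = q_k^{(wt(a), h_k)} v_a`. -/
def vecAct (X : AffType) (n : ℕ) : DGen n → (V X n →ₗ[K] V X n)
  | .e k => Matrix.toLin' (Matrix.of fun a b =>
      if Arrow X n k a b then qInt X n k (outCount X n k a) else 0)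
  | .f k => Matrix.toLin' (Matrix.of fun b a =>
      if Arrow X n k a b then qInt X n k (inCount X n k b) else 0)
  | .t k => Matrix.toLin' (Matrix.diagonal fun a => qi X n k ^ wt X n a k)
  | .tinv k => Matrix.toLin' (Matrix.diagonal fun a => qi X n k ^ (-wt X n a k))

/-- The dual action `(x · v*)(u) = v*(S(x) u)`, where the antipode is
`S(e_i) = -t_i⁻¹ e_i`, `S(f_i) = -f_i t_i`, `S(t_i) = t_i⁻¹`. -/
def dualAct {n : ℕ} {W : Type*} [AddCommGroup W] [Module K W] (ρ : DGen n → (W →ₗ[K] W)) :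
    DGen n → (Module.Dual K W →ₗ[K] Module.Dual K W)
  | .e i => (-(ρ (.tinv i) ∘ₗ ρ (.e i))).dualMap
  | .f i => (-(ρ (.f i) ∘ₗ ρ (.t i))).dualMap
  | .t i => (ρ (.tinv i)).dualMap
  | .tinv i => (ρ (.t i)).dualMap

/-- The completed tensor product `N ⊗̂ W_z`, where `W_z = W ⊗ K[z, z⁻¹]`: formal series
`∑_{m ∈ ℤ} x_m z^m` with arbitrary coefficients `x_m ∈ N ⊗ W`. -/
abbrev CTensor (N W : Type*) [AddCommGroup N] [Module K N] [AddCommGroup W] [Module K W] : Type _ :=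
  ℤ → N ⊗[K] W

/-- `δ_{k0}`. -/
def del {n : ℕ} (k : Fin (n + 1)) : ℤ := if k = 0 then 1 else 0

/-- The action of the generators of `U_q'(ĝ)` on `N ⊗̂ W_z` through the coproduct
`Δ(e_k) = e_k ⊗ 1 + t_k ⊗ e_k`, `Δ(f_k) = f_k ⊗ t_k⁻¹ + 1 ⊗ f_k`, `Δ(t_k) = t_k ⊗ t_k`, where on
`W_z` one has `e_k (w z^m) = (e_k w) z^{m + δ_{k0}}`, `f_k (w z^m) = (f_k w) z^{m - δ_{k0}}`,
`t_k (w z^m) = (t_k w) z^m`. -/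
def tensorAct (X : AffType) {n : ℕ} (N : Type*) [AddCommGroup N] [Module K N] [Module (Uq X n) N]
    [IsScalarTower K (Uq X n) N] {W : Type*} [AddCommGroup W] [Module K W]
    (ρ : DGen n → (W →ₗ[K] W)) : DGen n → CTensor N W → CTensor N W
  | .e k, x => fun m =>
      TensorProduct.map (act X N (.e k)) LinearMap.id (x m)
        + TensorProduct.map (act X N (.t k)) (ρ (.e k)) (x (m - del k))
  | .f k, x => fun m =>
      TensorProduct.map (act X N (.f k)) (ρ (.tinv k)) (x m)
        + TensorProduct.map LinearMap.id (ρ (.f k)) (x (m + del k))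
  | .t k, x => fun m => TensorProduct.map (act X N (.t k)) (ρ (.t k)) (x m)
  | .tinv k, x => fun m => TensorProduct.map (act X N (.tinv k)) (ρ (.tinv k)) (x m)

/-- `Φ : M → N ⊗̂ W_z` is a type I vertex operator: it commutes with `U_q'(ĝ)`, equivalently with
the generators of this algebra. -/
def IsVertexOperatorI (X : AffType) {n : ℕ} {M N : Type*} [AddCommGroup M] [Module K M]
    [Module (Uq X n) M] [IsScalarTower K (Uq X n) M] [AddCommGroup N] [Module K N]
    [Module (Uq X n) N] [IsScalarTower K (Uq X n) N] {W : Type*} [AddCommGroup W] [Module K W]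
    (ρ : DGen n → (W →ₗ[K] W)) (Φ : M →ₗ[K] CTensor N W) : Prop :=
  ∀ (g : DGen n) (u : M), Φ (act X M g u) = tensorAct X N ρ g (Φ u)

/-! ### Components and `q`-commutators -/

/-- A formal series `∑_{m ∈ ℤ} A_m z^m` whose coefficients are operators `M → N`. -/
abbrev OpSeries (M N : Type*) [AddCommGroup M] [Module K M] [AddCommGroup N] [Module K N] : Type _ :=
  ℤ → (M →ₗ[K] N)

/-- The series obtained by applying a functional `ξ` on `W` to the second tensor factor. -/
def pairing {M N W : Type*} [AddCommGroup M] [Module K M] [AddCommGroup N] [Module K N]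
    [AddCommGroup W] [Module K W] (ξ : W →ₗ[K] K) (Φ : M →ₗ[K] CTensor N W) : OpSeries M N :=
  fun m => (TensorProduct.rid K N).toLinearMap ∘ₗ (TensorProduct.map LinearMap.id ξ) ∘ₗ
    LinearMap.proj m ∘ₗ Φ

/-- The component `Φ_j(z)` in `Φ(z) u = ∑_j Φ_j(z) u ⊗ v_j`. -/
def comp {X : AffType} {n : ℕ} {M N : Type*} [AddCommGroup M] [Module K M] [AddCommGroup N]
    [Module K N] (Φ : M →ₗ[K] CTensor N (V X n)) (j : Vertex X n) : OpSeries M N :=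
  pairing (LinearMap.proj j) Φ

/-- The component `Φ*_j(z)` in `Φ*(z) u = ∑_j Φ*_j(z) u ⊗ v_j*`, where `(v_j*)` is the basis dual
to `(v_j)`. -/
def dualComp {X : AffType} {n : ℕ} {M N : Type*} [AddCommGroup M] [Module K M] [AddCommGroup N]
    [Module K N] (Φ : M →ₗ[K] CTensor N (Module.Dual K (V X n))) (j : Vertex X n) :
    OpSeries M N :=
  pairing (Module.Dual.eval K (V X n) (vbasis X n j)) Φ

/-- `z^d A(z)`. -/
def zmul {M N : Type*} [AddCommGroup M] [Module K M] [AddCommGroup N] [Module K N]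
    (d : ℤ) (A : OpSeries M N) : OpSeries M N := fun m => A (m - d)

section Commutators

variable (X : AffType) {n : ℕ} {M N : Type*} [AddCommGroup M] [Module K M]
  [Module (Uq X n) M] [IsScalarTower K (Uq X n) M] [AddCommGroup N] [Module K N]
  [Module (Uq X n) N] [IsScalarTower K (Uq X n) N]

/-- `[A(z), f_k]_c = A(z) f_k - c f_k A(z)`. -/
def commRight (c : K) (A : OpSeries M N) (k : Fin (n + 1)) : OpSeries M N :=
  fun m => A m ∘ₗ act X M (.f k) - c • (act X N (.f k) ∘ₗ A m)

/-- `[f_k, A(z)]_c = f_k A(z) - c A(z) f_k`. -/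
def commLeft (c : K) (k : Fin (n + 1)) (A : OpSeries M N) : OpSeries M N :=
  fun m => act X N (.f k) ∘ₗ A m - c • (A m ∘ₗ act X M (.f k))

end Commutators

end

end QAffine

/-! Only the intertwining relation for `f_k` is needed. Apply a functional on `W` to the second
tensor factor of `Φ(z) f_k u = Δ(f_k) Φ(z) u`. For `W = V` and the coordinate at `j`, the term `f_k
⊗ t_k⁻¹` contributes `q_k^{-(wt(j), h_k)} f_k Φ_j(z)`. The term `1 ⊗ f_k` contributes only `[r_j]_k
z^{-δ_{k0}} Φ_i(z)`, because `i → j` is the only `k`-arrow into `j`. Since `q` is not a root of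
unity, `[r_j]_k ≠ 0` and the identity can be solved for `Φ_i(z)`: this is `comp_eq`. For `V*` one
evaluates at `v_i`; the antipode `S(f_k) = -f_k t_k` produces a sign and a factor `q_k^{(wt(i),
h_k)}`, and solving for `Φ*_j(z)` gives `dualComp_eq`.

The recursions run against the arrows for `V` and along them for `V*`. Uniqueness therefore follows
from `reachable_last` and `reachable_first`: every vertex is joined by a directed path to the last
vertex, and from vertex `1`. Equal components force equal operators because `(v_j)` and `(v_j*)` are
finite bases. -/

namespace QAffine

open Relation

/-! ### Combinatorics of the representation graphs -/

/-- A vertex has at most one incoming arrow of a given color. -/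
theorem LabelArrow.source_unique {X : AffType} {n k : ℕ} {a a' b : Label}
    (h : LabelArrow X n k a b) (h' : LabelArrow X n k a' b) : a = a' := by
  -- Separate targets let both case splits unify; matching `b` with `c` is then label arithmetic.
  generalize hb : b = c at h'
  cases h <;> cases h' <;> grind

/-- A vertex has at most one outgoing arrow of a given color. -/
theorem LabelArrow.target_unique {X : AffType} {n k : ℕ} {a b b' : Label}
    (h : LabelArrow X n k a b) (h' : LabelArrow X n k a b') : b = b' := by
  generalize ha : a = c at h'
  cases h <;> cases h' <;> grind

theorem Arrow.source_unique {X : AffType} {n : ℕ} {k : Fin (n + 1)} {a a' b : Vertex X n}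
    (h : Arrow X n k a b) (h' : Arrow X n k a' b) : a = a' :=
  Subtype.ext (LabelArrow.source_unique h h')

theorem Arrow.target_unique {X : AffType} {n : ℕ} {k : Fin (n + 1)} {a b b' : Vertex X n}
    (h : Arrow X n k a b) (h' : Arrow X n k a b') : b = b' :=
  Subtype.ext (LabelArrow.target_unique h h')

theorem Arrow.inCount_ne_zero {X : AffType} {n : ℕ} {k : Fin (n + 1)} {a b : Vertex X n}
    (h : Arrow X n k a b) : inCount X n k b ≠ 0 :=
  -- The arrow counts itself. Finiteness matters, as `ncard` is `0` on infinite sets.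
  Set.ncard_ne_zero_of_mem (a := (a, b)) ⟨h, .refl⟩ (Set.toFinite _)

/-- There is an arrow of some color from `a` to `b`. -/
def Adjacent (X : AffType) (n : ℕ) (a b : Vertex X n) : Prop := ∃ k, Arrow X n k a b

/-- The relation `Adjacent` on labels. -/
def LabelAdjacent (X : AffType) (n : ℕ) (a b : Label) : Prop :=
  a ∈ vertices X n ∧ b ∈ vertices X n ∧ ∃ k ≤ n, LabelArrow X n k a b

/-- Paths are built on bare labels, free of membership proofs; `LabelAdjacent` records enough to
lift them to vertices. -/
theorem reachable_of_label {X : AffType} {n : ℕ} {a b : Label}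
    (h : ReflTransGen (LabelAdjacent X n) a b) (ha : a ∈ vertices X n) (hb : b ∈ vertices X n) :
    ReflTransGen (Adjacent X n) ⟨a, ha⟩ ⟨b, hb⟩ := by
  induction h with
  | refl => exact .refl
  | tail _ h ih =>
    obtain ⟨hc, _, k, hk, hkarr⟩ := h
    exact (ih hc).tail ⟨⟨k, Nat.lt_succ_of_le hk⟩, hkarr⟩

theorem mem_vertices_pos {X : AffType} {n i : ℕ} (h1 : 1 ≤ i) (h2 : i ≤ n) :
    .pos i ∈ vertices X n := by
  cases X <;> simp [vertices] <;> omega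

theorem mem_vertices_bar {X : AffType} {n i : ℕ} (hX : X ≠ .A) (h1 : 1 ≤ i) (h2 : i ≤ n) :
    .bar i ∈ vertices X n := by
  cases X <;> simp [vertices] at hX ⊢ <;> omega

theorem reachable_pos {X : AffType} {n i j : ℕ} (h1 : 1 ≤ i) (hij : i ≤ j) (hj : j ≤ n) :
    ReflTransGen (LabelAdjacent X n) (.pos i) (.pos j) := by
  induction j, hij using Nat.le_induction with
  | base => exact .refl
  | succ j hij ih =>
    refine (ih (by omega)).tail ⟨mem_vertices_pos (by omega) (by omega),
      mem_vertices_pos (by omega) (by omega), j, by omega, ?_⟩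
    cases X
    · exact .A_pos n j (by omega) (by omega)
    · exact .B_pos n j (by omega) (by omega)
    · exact .C_pos n j (by omega) (by omega)
    · exact .D_pos n j (by omega) (by omega)

theorem reachable_bar {X : AffType} {n i j : ℕ} (hX : X ≠ .A) (h1 : 1 ≤ i) (hij : i ≤ j)
    (hj : j ≤ n) : ReflTransGen (LabelAdjacent X n) (.bar j) (.bar i) := by
  induction j, hij using Nat.le_induction with
  | base => exact .refl
  | succ j hij ih =>
    refine (ih (by omega)).head ⟨mem_vertices_bar hX (by omega) (by omega),
      mem_vertices_bar hX (by omega) (by omega), j, by omega, ?_⟩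
    cases X
    · exact absurd rfl hX
    · exact .B_bar n j (by omega) (by omega)
    · exact .C_bar n j (by omega) (by omega)
    · exact .D_bar n j (by omega) (by omega)

theorem labelAdjacent_last_A {n : ℕ} (hn : 1 ≤ n) :
    LabelAdjacent .A n (.pos n) (.pos (n + 1)) :=
  ⟨by simp [vertices]; omega, by simp [vertices], n, le_rfl, .A_pos n n hn le_rfl⟩

theorem labelAdjacent_zero_B {n : ℕ} (hn : 1 ≤ n) : LabelAdjacent .B n (.pos n) .zero :=
  ⟨mem_vertices_pos hn le_rfl, by simp [vertices], n, le_rfl, .B_to_zero n⟩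

theorem labelAdjacent_bar_B {n : ℕ} (hn : 1 ≤ n) : LabelAdjacent .B n .zero (.bar n) :=
  ⟨by simp [vertices], mem_vertices_bar (by simp) hn le_rfl, n, le_rfl, .B_from_zero n⟩

/-- In types `B` and `C` one bridge from `n` to `n̄` gives both halves. In type `D` the color-`n`
arrows cross, joining `n` to the bar of `n - 1` and `n - 1` to `n̄`, so each half has its own
bridge. -/
theorem reachable_pos_bar {X : AffType} {n : ℕ} (hX : X ≠ .A) (hn : X.minRank ≤ n) :
    ReflTransGen (LabelAdjacent X n) (.pos n) (.bar 1) ∧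
      ReflTransGen (LabelAdjacent X n) (.pos 1) (.bar n) := by
  cases X
  · exact absurd rfl hX
  · simp only [AffType.minRank] at hn
    have h : ReflTransGen (LabelAdjacent .B n) (.pos n) (.bar n) :=
      (ReflTransGen.single (labelAdjacent_zero_B (by omega))).tail
        (labelAdjacent_bar_B (by omega))
    exact ⟨h.trans (reachable_bar hX le_rfl (by omega) le_rfl),
      (reachable_pos le_rfl (by omega) le_rfl).trans h⟩
  · simp only [AffType.minRank] at hn
    have h : LabelAdjacent .C n (.pos n) (.bar n) :=
      ⟨mem_vertices_pos (by omega) le_rfl, mem_vertices_bar hX (by omega) le_rfl, n, le_rfl,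
        .C_mid n⟩
    exact ⟨(reachable_bar hX le_rfl (by omega) le_rfl).head h,
      (reachable_pos le_rfl (by omega) le_rfl).tail h⟩
  · simp only [AffType.minRank] at hn
    obtain ⟨m, rfl⟩ : ∃ m, n = m + 1 := ⟨n - 1, by omega⟩
    constructor
    · exact (reachable_bar hX le_rfl (by omega) (Nat.le_succ m)).head
        ⟨mem_vertices_pos (by omega) le_rfl, mem_vertices_bar hX (by omega) (by omega), m + 1,
          le_rfl, .D_mid2 (m + 1) m rfl⟩
    · exact (reachable_pos le_rfl (by omega) (Nat.le_succ m)).tail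
        ⟨mem_vertices_pos (by omega) (by omega), mem_vertices_bar hX (by omega) le_rfl, m + 1,
          le_rfl, .D_mid1 (m + 1) m rfl⟩

theorem reachable_label {X : AffType} {n : ℕ} (hn : X.minRank ≤ n) {a : Label}
    (ha : a ∈ vertices X n) :
    ReflTransGen (LabelAdjacent X n) a (lastVertex X n hn).1 ∧
      ReflTransGen (LabelAdjacent X n) (.pos 1) a := by
  by_cases hX : X = .A
  · subst hX
    simp only [AffType.minRank] at hn
    simp only [vertices, Finset.mem_image, Finset.mem_Icc] at ha
    obtain ⟨i, ⟨h1, h2⟩, rfl⟩ := ha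
    -- The vertex `n + 1` lies beyond the range of `reachable_pos` and is attached by one extra
    -- arrow.
    rcases Nat.le_succ_iff.1 h2 with h | rfl
    · exact ⟨(reachable_pos h1 h le_rfl).tail (labelAdjacent_last_A hn),
        reachable_pos le_rfl h1 h⟩
    · exact ⟨.refl, (reachable_pos le_rfl hn le_rfl).tail (labelAdjacent_last_A hn)⟩
  · have hn1 : 1 ≤ n := by cases X <;> simp [AffType.minRank] at hn <;> omega
    obtain ⟨h1, h2⟩ := reachable_pos_bar hX hn
    have hlast : (lastVertex X n hn).1 = .bar 1 := by
      cases X <;> first | rfl | exact absurd rfl hX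
    rw [hlast]
    have hp (i : ℕ) (hi : 1 ≤ i ∧ i ≤ n) :
        ReflTransGen (LabelAdjacent X n) (.pos i) (.bar 1) ∧
          ReflTransGen (LabelAdjacent X n) (.pos 1) (.pos i) :=
      ⟨(reachable_pos hi.1 hi.2 le_rfl).trans h1, reachable_pos le_rfl hi.1 hi.2⟩
    have hb (i : ℕ) (hi : 1 ≤ i ∧ i ≤ n) :
        ReflTransGen (LabelAdjacent X n) (.bar i) (.bar 1) ∧
          ReflTransGen (LabelAdjacent X n) (.pos 1) (.bar i) :=
      ⟨reachable_bar hX le_rfl hi.1 hi.2, h2.trans (reachable_bar hX hi.1 hi.2 le_rfl)⟩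
    cases a with
    | pos i => exact hp i (by cases X <;> simp [vertices] at hX ha <;> omega)
    | bar i => exact hb i (by cases X <;> simp [vertices] at hX ha <;> omega)
    | zero =>
      obtain rfl : X = .B := by cases X <;> simp [vertices] at ha ⊢
      exact ⟨(reachable_bar hX le_rfl hn1 le_rfl).head (labelAdjacent_bar_B hn1),
        (reachable_pos le_rfl hn1 le_rfl).tail (labelAdjacent_zero_B hn1)⟩

theorem reachable_last {X : AffType} {n : ℕ} (hn : X.minRank ≤ n) (a : Vertex X n) :
    ReflTransGen (Adjacent X n) a (lastVertex X n hn) :=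
  reachable_of_label (reachable_label hn a.2).1 a.2 _

theorem reachable_first {X : AffType} {n : ℕ} (hn : X.minRank ≤ n) (a : Vertex X n) :
    ReflTransGen (Adjacent X n) (firstVertex X n hn) a :=
  reachable_of_label (reachable_label hn a.2).2 _ a.2

/-! ### `q`-integers -/

theorem qHalf_pow_ne_one {m : ℕ} (hm : m ≠ 0) : qHalf ^ m ≠ 1 := by
  intro h
  have h' : algebraMap (Polynomial ℂ) (RatFunc ℂ) (Polynomial.X ^ m) =
      algebraMap (Polynomial ℂ) (RatFunc ℂ) 1 := by
    simpa [qHalf] using h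
  -- The degrees are `m` and `0`.
  have := congrArg Polynomial.natDegree (RatFunc.algebraMap_injective ℂ h')
  simp [hm] at this

theorem qi_ne_zero (X : AffType) (n : ℕ) (k : Fin (n + 1)) : qi X n k ≠ 0 :=
  zpow_ne_zero _ RatFunc.X_ne_zero

theorem qi_pow_ne_one (X : AffType) (n : ℕ) (k : Fin (n + 1)) {m : ℕ} (hm : m ≠ 0) :
    qi X n k ^ m ≠ 1 := by
  obtain ⟨d, hd, h⟩ : ∃ d : ℕ, d ≠ 0 ∧ twoD X n k = d := by
    cases X <;> simp only [twoD] <;> try split_ifs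
    all_goals first | exact ⟨2, by simp, rfl⟩ | exact ⟨1, by simp, rfl⟩
  rw [qi, h, zpow_natCast, ← pow_mul]
  exact qHalf_pow_ne_one (mul_ne_zero hd hm)

/-- A vanishing numerator would give `q_i^{2m} = 1`. The case `m = 1` of the same argument handles
the denominator. -/
theorem qInt_ne_zero (X : AffType) (n : ℕ) (k : Fin (n + 1)) {m : ℕ} (hm : m ≠ 0) :
    qInt X n k m ≠ 0 := by
  have key {m : ℕ} (hm : m ≠ 0) : qi X n k ^ m - (qi X n k)⁻¹ ^ m ≠ 0 := by
    intro h
    have h0 : qi X n k ^ m ≠ 0 := pow_ne_zero _ (qi_ne_zero X n k)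
    rw [sub_eq_zero, inv_pow, ← mul_eq_one_iff_eq_inv₀ h0, ← pow_add] at h
    exact qi_pow_ne_one X n k (by omega) h
  exact div_ne_zero (key hm) (by simpa using key one_ne_zero)

/-! ### Contraction of the second tensor factor -/

section Contraction

variable {M N W : Type*} [AddCommGroup M] [Module K M] [AddCommGroup N] [Module K N]
  [AddCommGroup W] [Module K W]

/-- The map `N ⊗ W → N` obtained by applying a functional to the second factor. -/
noncomputable def contract (N : Type*) [AddCommGroup N] [Module K N] (ξ : W →ₗ[K] K) :
    N ⊗[K] W →ₗ[K] N :=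
  (TensorProduct.rid K N).toLinearMap ∘ₗ TensorProduct.map LinearMap.id ξ

@[simp]
theorem contract_tmul (ξ : W →ₗ[K] K) (x : N) (w : W) : contract N ξ (x ⊗ₜ w) = ξ w • x := by
  simp [contract]

theorem contract_smul (c : K) (ξ : W →ₗ[K] K) (x : N ⊗[K] W) :
    contract N (c • ξ) x = c • contract N ξ x := by
  simp [contract, TensorProduct.map_smul_right]

theorem pairing_apply (ξ : W →ₗ[K] K) (Φ : M →ₗ[K] CTensor N W) (m : ℤ) (u : M) :
    pairing ξ Φ m u = contract N ξ (Φ u m) := rfl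

/-- Transposing `g` onto the functional turns a coproduct formula into a relation between
components. -/
theorem contract_map (ξ : W →ₗ[K] K) (f : N →ₗ[K] N) (g : W →ₗ[K] W) (x : N ⊗[K] W) :
    contract N ξ (TensorProduct.map f g x) = f (contract N (ξ ∘ₗ g) x) := by
  induction x with
  | zero => simp
  | tmul x w => simp
  | add x y hx hy => simp [hx, hy]

theorem eq_sum_contract {ι : Type*} [Fintype ι] (b : Module.Basis ι K W) (x : N ⊗[K] W) :
    x = ∑ i, contract N (b.coord i) x ⊗ₜ[K] b i := by
  induction x with
  | zero => simp
  | tmul x w =>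
    conv_lhs => rw [← b.sum_repr w, TensorProduct.tmul_sum]
    simp [TensorProduct.smul_tmul]
  | add x y hx hy =>
    simp only [map_add, TensorProduct.add_tmul, Finset.sum_add_distrib]
    rw [← hx, ← hy]

theorem ext_of_pairing {ι : Type*} [Fintype ι] (b : Module.Basis ι K W)
    {Φ Ψ : M →ₗ[K] CTensor N W} (h : ∀ i, pairing (b.coord i) Φ = pairing (b.coord i) Ψ) :
    Φ = Ψ := by
  ext u m
  rw [eq_sum_contract b (Φ u m), eq_sum_contract b (Ψ u m)]
  exact Finset.sum_congr rfl fun i _ => by rw [← pairing_apply, ← pairing_apply, h i]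

end Contraction

/-! ### Matrix coefficients of the generators -/

section Coefficients

variable {X : AffType} {n : ℕ}

theorem proj_comp_vecAct_tinv (k : Fin (n + 1)) (j : Vertex X n) :
    (LinearMap.proj j : V X n →ₗ[K] K) ∘ₗ vecAct X n (.tinv k) =
      qi X n k ^ (-wt X n j k) • LinearMap.proj j := by
  ext a
  simp [vecAct, Matrix.mulVec_diagonal]

theorem proj_comp_vecAct_f {k : Fin (n + 1)} {i j : Vertex X n} (h : Arrow X n k i j) :
    (LinearMap.proj j : V X n →ₗ[K] K) ∘ₗ vecAct X n (.f k) =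
      qInt X n k (inCount X n k j) • LinearMap.proj i := by
  classical
  refine LinearMap.ext fun v => ?_
  simp only [vecAct, LinearMap.comp_apply, LinearMap.proj_apply, Matrix.toLin'_apply,
    Matrix.mulVec, dotProduct, Matrix.of_apply, LinearMap.smul_apply, smul_eq_mul]
  rw [Finset.sum_eq_single i, if_pos h]
  · intro a _ ha
    -- Row `j` of the matrix of `f_k` has its only nonzero entry in column `i`.
    rw [if_neg fun h' => ha (h'.source_unique h), zero_mul]
  · simp

theorem vecAct_t_vbasis (k : Fin (n + 1)) (i : Vertex X n) :
    vecAct X n (.t k) (vbasis X n i) = qi X n k ^ wt X n i k • vbasis X n i := by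
  ext a
  by_cases h : a = i
  · subst h; simp [vecAct, vbasis, Matrix.mulVec_diagonal]
  · simp [vecAct, vbasis, Matrix.mulVec_diagonal, h]

theorem vecAct_f_vbasis {k : Fin (n + 1)} {i j : Vertex X n} (h : Arrow X n k i j) :
    vecAct X n (.f k) (vbasis X n i) = qInt X n k (inCount X n k j) • vbasis X n j := by
  classical
  ext a
  by_cases ha : a = j
  · subst ha; simp [vecAct, vbasis, h]
  · have : ¬ Arrow X n k i a := fun h' => ha (h'.target_unique h)
    simp [vecAct, vbasis, ha, this]

theorem eval_comp_dualAct_tinv (k : Fin (n + 1)) (i : Vertex X n) :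
    Module.Dual.eval K (V X n) (vbasis X n i) ∘ₗ dualAct (vecAct X n) (.tinv k) =
      qi X n k ^ wt X n i k • Module.Dual.eval K (V X n) (vbasis X n i) := by
  refine LinearMap.ext fun ξ => ?_
  simp [dualAct, vecAct_t_vbasis]

/-- In `S(f_k) v_i = -f_k t_k v_i` the factor `t_k` acts first, so the weight is that of `i`, not of
`j`. -/
theorem eval_comp_dualAct_f {k : Fin (n + 1)} {i j : Vertex X n} (h : Arrow X n k i j) :
    Module.Dual.eval K (V X n) (vbasis X n i) ∘ₗ dualAct (vecAct X n) (.f k) =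
      (-(qi X n k ^ wt X n i k * qInt X n k (inCount X n k j))) •
        Module.Dual.eval K (V X n) (vbasis X n j) := by
  refine LinearMap.ext fun ξ => ?_
  simp [dualAct, vecAct_t_vbasis, vecAct_f_vbasis h, mul_assoc]

end Coefficients

/-! ### The recursions and their consequences -/

section VertexOperators

variable {X : AffType} {n : ℕ} {M N : Type*} [AddCommGroup M] [Module K M]
  [Module (Uq X n) M] [IsScalarTower K (Uq X n) M] [AddCommGroup N] [Module K N]
  [Module (Uq X n) N] [IsScalarTower K (Uq X n) N]

/-- The intertwining property for `f_k`, paired with a functional `ξ` on `W`. -/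
theorem IsVertexOperatorI.pairing_f {W : Type*} [AddCommGroup W] [Module K W]
    {ρ : DGen n → (W →ₗ[K] W)} {Φ : M →ₗ[K] CTensor N W} (hΦ : IsVertexOperatorI X ρ Φ)
    (ξ : W →ₗ[K] K) (k : Fin (n + 1)) (m : ℤ) (u : M) :
    pairing ξ Φ m (act X M (.f k) u) =
      act X N (.f k) (pairing (ξ ∘ₗ ρ (.tinv k)) Φ m u) +
        pairing (ξ ∘ₗ ρ (.f k)) Φ (m + del k) u := by
  simp only [pairing_apply]
  rw [hΦ (.f k) u]
  simp only [tensorAct, map_add, contract_map, LinearMap.id_apply]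

theorem IsVertexOperatorI.comp_eq {Φ : M →ₗ[K] CTensor N (V X n)}
    (hΦ : IsVertexOperatorI X (vecAct X n) Φ) {k : Fin (n + 1)} {i j : Vertex X n}
    (h : Arrow X n k i j) :
    comp Φ i = (qInt X n k (inCount X n k j))⁻¹ •
      zmul (del k) (commRight X (qi X n k ^ (-wt X n j k)) (comp Φ j) k) := by
  funext m
  ext u
  -- The degree `m - δ_{k0}` puts the component at `i` in degree `m`; this shift is the factor
  -- `z^{δ_{k0}}`.
  have key := hΦ.pairing_f (LinearMap.proj j) k (m - del k) u
  rw [proj_comp_vecAct_tinv, proj_comp_vecAct_f h, sub_add_cancel] at key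
  simp only [pairing_apply, contract_smul, map_smul] at key
  have h0 := qInt_ne_zero X n k h.inCount_ne_zero
  simp only [Pi.smul_apply, LinearMap.smul_apply, zmul, commRight, LinearMap.sub_apply,
    LinearMap.comp_apply, comp, pairing_apply]
  rw [eq_inv_smul_iff₀ h0, key, add_sub_cancel_left]

theorem IsVertexOperatorI.dualComp_eq {Φ : M →ₗ[K] CTensor N (Module.Dual K (V X n))}
    (hΦ : IsVertexOperatorI X (dualAct (vecAct X n)) Φ) {k : Fin (n + 1)} {i j : Vertex X n}
    (h : Arrow X n k i j) :
    dualComp Φ j = (qInt X n k (inCount X n k j))⁻¹ •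
      zmul (del k) (commLeft X (qi X n k ^ (-wt X n i k)) k (dualComp Φ i)) := by
  funext m
  ext u
  have key := hΦ.pairing_f (Module.Dual.eval K (V X n) (vbasis X n i)) k (m - del k) u
  rw [eval_comp_dualAct_tinv, eval_comp_dualAct_f h, sub_add_cancel] at key
  simp only [pairing_apply, contract_smul, map_smul] at key
  have h0 := qInt_ne_zero X n k h.inCount_ne_zero
  have hq : qi X n k ^ wt X n i k ≠ 0 := zpow_ne_zero _ (qi_ne_zero X n k)
  simp only [Pi.smul_apply, LinearMap.smul_apply, zmul, commLeft, LinearMap.sub_apply,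
    LinearMap.comp_apply, dualComp, pairing_apply]
  -- Multiplying the relation by `q_k^{-(wt(i), h_k)}` clears this weight factor from both terms:
  -- the `f_k` terms cancel and the sign from the antipode is absorbed.
  rw [eq_inv_smul_iff₀ h0, key, smul_add, smul_smul, smul_smul, zpow_neg, inv_mul_cancel₀ hq,
    one_smul, mul_neg, inv_mul_cancel_left₀ hq, neg_smul]
  abel

theorem IsVertexOperatorI.ext_lastVertex (hn : X.minRank ≤ n)
    {Φ Ψ : M →ₗ[K] CTensor N (V X n)} (hΦ : IsVertexOperatorI X (vecAct X n) Φ)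
    (hΨ : IsVertexOperatorI X (vecAct X n) Ψ)
    (h : comp Φ (lastVertex X n hn) = comp Ψ (lastVertex X n hn)) : Φ = Ψ := by
  have hcomp (i : Vertex X n) : comp Φ i = comp Ψ i := by
    -- The recursion gives the source of an arrow from its target, so the induction prepends arrows
    -- to a path ending at the last vertex.
    induction reachable_last hn i using ReflTransGen.head_induction_on with
    | refl => exact h
    | head hij _ ih =>
      obtain ⟨k, hk⟩ := hij
      rw [hΦ.comp_eq hk, hΨ.comp_eq hk, ih]
  refine ext_of_pairing (Pi.basisFun K (Vertex X n)) fun i => ?_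
  have : (Pi.basisFun K (Vertex X n)).coord i = LinearMap.proj i :=
    LinearMap.ext fun v => by simp
  rw [this]
  exact hcomp i

theorem IsVertexOperatorI.ext_firstVertex (hn : X.minRank ≤ n)
    {Φ Ψ : M →ₗ[K] CTensor N (Module.Dual K (V X n))}
    (hΦ : IsVertexOperatorI X (dualAct (vecAct X n)) Φ)
    (hΨ : IsVertexOperatorI X (dualAct (vecAct X n)) Ψ)
    (h : dualComp Φ (firstVertex X n hn) = dualComp Ψ (firstVertex X n hn)) : Φ = Ψ := by
  have hcomp (i : Vertex X n) : dualComp Φ i = dualComp Ψ i := by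
    -- Here targets come from sources, so paths from vertex `1` grow at their end.
    induction reachable_first hn i with
    | refl => exact h
    | tail _ hij ih =>
      obtain ⟨k, hk⟩ := hij
      rw [hΦ.dualComp_eq hk, hΨ.dualComp_eq hk, ih]
  refine ext_of_pairing (Pi.basisFun K (Vertex X n)).dualBasis fun i => ?_
  have : (Pi.basisFun K (Vertex X n)).dualBasis.coord i =
      Module.Dual.eval K (V X n) (vbasis X n i) :=
    LinearMap.ext fun ξ => by simp [vbasis]
  rw [this]
  exact hcomp i

end VertexOperators

end QAffine

theorem propositionP (X : QAffine.AffType) (n : ℕ) (hn : X.minRank ≤ n)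
    {M N : Type*}
    [AddCommGroup M] [Module QAffine.K M] [Module (QAffine.Uq X n) M]
    [IsScalarTower QAffine.K (QAffine.Uq X n) M]
    [AddCommGroup N] [Module QAffine.K N] [Module (QAffine.Uq X n) N]
    [IsScalarTower QAffine.K (QAffine.Uq X n) N]
    (lam mu : QAffine.Coweight n → QAffine.K)
    (_hM : QAffine.IsHighestWeightModule X n lam M)
    (_hN : QAffine.IsHighestWeightModule X n mu N) :
    -- a vertex operator with respect to `V_z` is determined by its component at the last vertex
    (∀ Φ Ψ : M →ₗ[QAffine.K] QAffine.CTensor N (QAffine.V X n),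
      QAffine.IsVertexOperatorI X (QAffine.vecAct X n) Φ →
      QAffine.IsVertexOperatorI X (QAffine.vecAct X n) Ψ →
      QAffine.comp Φ (QAffine.lastVertex X n hn) = QAffine.comp Ψ (QAffine.lastVertex X n hn) →
      Φ = Ψ) ∧
    -- the recursion with respect to `V_z`
    (∀ Φ : M →ₗ[QAffine.K] QAffine.CTensor N (QAffine.V X n),
      QAffine.IsVertexOperatorI X (QAffine.vecAct X n) Φ →
      ∀ (k : Fin (n + 1)) (i j : QAffine.Vertex X n), QAffine.Arrow X n k i j →
        QAffine.comp Φ i =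
          (QAffine.qInt X n k (QAffine.inCount X n k j))⁻¹ •
            QAffine.zmul (QAffine.del k)
              (QAffine.commRight X (QAffine.qi X n k ^ (-QAffine.wt X n j k))
                (QAffine.comp Φ j) k)) ∧
    -- a vertex operator with respect to `V_z^*` is determined by its component at `1`
    (∀ Φ Ψ : M →ₗ[QAffine.K] QAffine.CTensor N (Module.Dual QAffine.K (QAffine.V X n)),
      QAffine.IsVertexOperatorI X (QAffine.dualAct (QAffine.vecAct X n)) Φ →
      QAffine.IsVertexOperatorI X (QAffine.dualAct (QAffine.vecAct X n)) Ψ →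
      QAffine.dualComp Φ (QAffine.firstVertex X n hn) =
        QAffine.dualComp Ψ (QAffine.firstVertex X n hn) →
      Φ = Ψ) ∧
    -- the recursion with respect to `V_z^*`
    (∀ Φ : M →ₗ[QAffine.K] QAffine.CTensor N (Module.Dual QAffine.K (QAffine.V X n)),
      QAffine.IsVertexOperatorI X (QAffine.dualAct (QAffine.vecAct X n)) Φ →
      ∀ (k : Fin (n + 1)) (i j : QAffine.Vertex X n), QAffine.Arrow X n k i j →
        QAffine.dualComp Φ j =
          (QAffine.qInt X n k (QAffine.inCount X n k j))⁻¹ •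
            QAffine.zmul (QAffine.del k)
              (QAffine.commLeft X (QAffine.qi X n k ^ (-QAffine.wt X n i k)) k
                (QAffine.dualComp Φ i))) := by
  exact ⟨fun _ _ hΦ hΨ h => hΦ.ext_lastVertex hn hΨ h, fun _ hΦ _ _ _ h => hΦ.comp_eq h,
    fun _ _ hΦ hΨ h => hΦ.ext_firstVertex hn hΨ h, fun _ hΦ _ _ _ h => hΦ.dualComp_eq h⟩
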